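/- Let $2\le p_0\le p_1\le p_\infty\le\infty$ be integers or $\infty$ with $\frac1{p_0}+\frac1{p_1}+\frac1{p_\infty}<1$ (convention $\frac1\infty=0$). Let $E$ be a hypergeometric equation on $\mathbb P^1$ with hyperbolic orbifold structure $(p_0,p_1,p_\infty)$ at $0,1,\infty$, i.e. a Fuchsian equation $u''+fu'+gu=0$, regular outside $\{0,1,\infty\}$, whose exponents (differences of the two local exponents, up to sign) at $0,1,\infty$ are $\frac1{p_0},\frac1{p_1},\frac1{p_\infty}$; up to projective equivalence this is the uniformizing equation of the orbifold. Let $\phi:\mathbb P^1\to\mathbb P^1$ be a rational map of degree $d$ which ramifies above (at least) two distinct points of $\mathbb P^1\setminus\{0,1,\infty\}$. Call a point of $\mathbb P^1$ a non-apparent singularity of a Fuchsian equation if the local projective monodromy of the equation around it is non-trivial. If the pull-back $\tilde E=\phi^*E$ has exactly $5$ non-apparent singularities, then $$d\left(1-\frac1{p_0}-\frac1{p_1}-\frac1{p_\infty}\right)\le 1-\frac5{p_\infty}.$$ -/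

import Mathlib

open Filter Topology

noncomputable section

/-- A second order linear differential equation `u'' + f u' + g u = 0` in one complex variable.
An equation on the Riemann sphere is given by its expression in the affine coordinate; the values
of `f` and `g` at their singularities are irrelevant. -/
structure LinODE where
  f : ℂ → ℂ
  g : ℂ → ℂ

namespace LinODE

/-- `u` is a holomorphic solution of `u'' + f u' + g u = 0` on the open set `Ω`. -/
def IsSolutionOn (E : LinODE) (u : ℂ → ℂ) (Ω : Set ℂ) : Prop :=
  DifferentiableOn ℂ u Ω ∧
    ∀ w ∈ Ω, deriv (deriv u) w + E.f w * deriv u w + E.g w * u w = 0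

/-- The pull-back `ψ^* E`: the equation satisfied by `u ∘ ψ` when `u` is a solution of `E`. -/
def pullback (E : LinODE) (ψ : ℂ → ℂ) : LinODE where
  f := fun z => E.f (ψ z) * deriv ψ z - deriv (deriv ψ) z / deriv ψ z
  g := fun z => E.g (ψ z) * deriv ψ z ^ 2

end LinODE

/-- Local parametrization of a punctured neighbourhood of `t` in the Riemann sphere `OnePoint ℂ` by
a punctured disc `0 < |s| < r`: `s ↦ t + s` for `t ∈ ℂ`, and `s ↦ 1 / s` for `t = ∞`. -/
def localParam : OnePoint ℂ → ℂ → ℂ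
  | none => fun s => s⁻¹
  | some t => fun s => t + s

namespace LinODE

/-- The point `t` of the sphere is at worst a regular singular point of `E`, with exponent `θ`
(difference of the two roots of the indicial equation `ρ (ρ - 1) + a ρ + b = 0`), defined up to
sign. -/
def HasExponentAt (E : LinODE) (t : OnePoint ℂ) (θ : ℂ) : Prop :=
  ∃ a b : ℂ,
    Tendsto (fun s => s * (E.pullback (localParam t)).f s) (𝓝[≠] 0) (𝓝 a) ∧
    Tendsto (fun s => s ^ 2 * (E.pullback (localParam t)).g s) (𝓝[≠] 0) (𝓝 b) ∧
    θ ^ 2 = (1 - a) ^ 2 - 4 * b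

/-- `E` is a hypergeometric equation with exponents `θ₀, θ₁, θInf`: a Fuchsian equation on the
sphere, regular outside `0, 1, ∞`, with these exponents at `0, 1, ∞`. -/
def IsHypergeometric (E : LinODE) (θ₀ θ₁ θInf : ℂ) : Prop :=
  AnalyticOnNhd ℂ E.f {0, 1}ᶜ ∧ AnalyticOnNhd ℂ E.g {0, 1}ᶜ ∧
    E.HasExponentAt ((0 : ℂ) : OnePoint ℂ) θ₀ ∧ E.HasExponentAt ((1 : ℂ) : OnePoint ℂ) θ₁ ∧
    E.HasExponentAt OnePoint.infty θInf

/-- The local projective monodromy of `E` around the point `t` of the sphere is trivial.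
The half-plane `Re w < R` is the universal covering of a punctured disc around `t`, through
`w ↦ localParam t (exp w)`, with deck transformation `w ↦ w + 2πi`; the condition is that the
monodromy of a fundamental system of solutions on this covering is a scalar matrix. -/
def HasTrivialMonodromyAt (E : LinODE) (t : OnePoint ℂ) : Prop :=
  ∃ (R : ℝ) (u v : ℂ → ℂ) (c : ℂ),
    (E.pullback fun w => localParam t (Complex.exp w)).IsSolutionOn u {w | w.re < R} ∧
    (E.pullback fun w => localParam t (Complex.exp w)).IsSolutionOn v {w | w.re < R} ∧
    (∀ w : ℂ, w.re < R → u w * deriv v w - deriv u w * v w ≠ 0) ∧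
    ∀ w : ℂ, w.re < R →
      u (w + 2 * Real.pi * Complex.I) = c * u w ∧ v (w + 2 * Real.pi * Complex.I) = c * v w

/-- The set of non-apparent singularities of `E` on the sphere: the points with non-trivial local
projective monodromy. (At a regular point it is trivial; a singular point where it is trivial is an
apparent singularity.) -/
def nonApparent (E : LinODE) : Set (OnePoint ℂ) :=
  {t | ¬ E.HasTrivialMonodromyAt t}

end LinODE

namespace RatMap

/-- The rational map `φ` of the sphere, in the affine coordinates (meaningful off the poles). -/
def toFun (φ : RatFunc ℂ) (z : ℂ) : ℂ := φ.eval (RingHom.id ℂ) z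

/-- The degree of `φ` as a ramified covering of the sphere by itself. -/
def degree (φ : RatFunc ℂ) : ℕ := max φ.num.natDegree φ.denom.natDegree

/-- `φ` ramifies above the finite value `c`: at some point `t` of the sphere, possibly `∞`,
`φ` takes the value `c` with multiplicity at least two. -/
def RamifiesAbove (φ : RatFunc ℂ) (c : ℂ) : Prop :=
  ∃ t : OnePoint ℂ, 2 ≤ meromorphicOrderAt (fun s => toFun φ (localParam t s) - c) 0

end RatMap

/-- `1 / p` for a weight `p` in `{1, 2, 3, …, ∞}`, with `1 / ∞ = 0`. -/
def recip (p : ℕ∞) : ℝ := ((p : ENNReal)⁻¹).toReal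

/-- `E` is a hypergeometric equation with integral orbifold structure `(p₀, p₁, pInf)` at `0, 1, ∞`,
where the weight is the inverse of the exponent: the exponents are `1 / p₀, 1 / p₁, 1 / pInf`
(exponent `0`, hence a logarithmic singularity, for the weight `∞`). In the hyperbolic case these
are, up to projective equivalence, the uniformizing equations of the orbifold. -/
def LinODE.HasOrbifoldStructure (E : LinODE) (p₀ p₁ pInf : ℕ∞) : Prop :=
  E.IsHypergeometric (recip p₀ : ℂ) (recip p₁ : ℂ) (recip pInf : ℂ)

end

/-! Write `d` for the degree, `rᵢ` for the three exponents `1 / pᵢ`, and count the points of `φ⁻¹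
{0, 1, ∞}` in two ways. Lower bound (`RatMap.degree_add_four_le`): by Hurwitz, total ramification is
at most `2 d - 2`. The two extra branch values use up at least 2 of it, so there are at least `d +
4` points above `0, 1, ∞`. Hurwitz is obtained algebraically: the Wronskian of numerator and
denominator is a binary form of degree `2 d - 2` vanishing to order at least `e - 1` at each point
of multiplicity `e`. Upper bound (`RatMap.card_fiber_le`): an apparent point of multiplicity `e`
above a point of exponent `r` has `e r` a nonzero integer, hence `e r ≥ 1`. So a fibre with `n`
non-apparent points has at most `d r + n (1 - r)` points. As `rInf` is the smallest exponent and
there are five non-apparent points, `d + 4 ≤ d (r₀ + r₁ + rInf) + 5 (1 - rInf)`, which is the claim.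
The analytic input is `HasExponentAt.exists_int_of_hasTrivialMonodromyAt`. In the logarithmic
coordinate `w`, the pulled-back equation has coefficients with limits `α`, `β` as `Re w → -∞`, and
`α² - 4 β = (e θ)²`. Scalar monodromy forces solutions `exp (r w) H (exp w)` whose exponents are two
distinct characteristic roots differing by an integer (`exists_int_sq_eq_discrim`). -/

/-! ### Functions near the left end of the complex plane -/

/-- The filter of neighbourhoods of the left end `Re w → -∞` of the complex plane. -/
def leftEnd : Filter ℂ := comap Complex.re atBot

theorem eventually_leftEnd {p : ℂ → Prop} :
    (∀ᶠ w in leftEnd, p w) ↔ ∃ R : ℝ, ∀ w : ℂ, w.re < R → p w := by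
  rw [leftEnd, eventually_comap, eventually_atBot]
  constructor
  · rintro ⟨R, h⟩
    exact ⟨R, fun w hw => h _ hw.le w rfl⟩
  · rintro ⟨R, h⟩
    exact ⟨R - 1, fun b hb w hw => h w (by linarith)⟩

instance : leftEnd.NeBot := by
  rw [← frequently_true_iff_neBot, Filter.Frequently, eventually_leftEnd]
  rintro ⟨R, h⟩
  exact h ((R - 1 : ℝ) : ℂ) (by simp) trivial

theorem tendsto_exp_leftEnd : Tendsto Complex.exp leftEnd (𝓝[≠] 0) := by
  rw [leftEnd, ← Complex.comap_exp_nhdsNE]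
  exact tendsto_comap

theorem isOpen_re_lt (R : ℝ) : IsOpen {w : ℂ | w.re < R} :=
  isOpen_lt Complex.continuous_re continuous_const

theorem Filter.Eventually.nhds_of_leftEnd {p : ℂ → Prop} (h : ∀ᶠ w in leftEnd, p w) :
    ∀ᶠ w in leftEnd, ∀ᶠ w' in 𝓝 w, p w' := by
  obtain ⟨R, h⟩ := eventually_leftEnd.1 h
  exact eventually_leftEnd.2 ⟨R, fun w hw =>
    Filter.mem_of_superset ((isOpen_re_lt R).mem_nhds hw) h⟩

theorem AnalyticAt.eventually_leftEnd_exp {H : ℂ → ℂ} (hH : AnalyticAt ℂ H 0) :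
    ∀ᶠ w in leftEnd, AnalyticAt ℂ H (Complex.exp w) :=
  (tendsto_exp_leftEnd.mono_right nhdsWithin_le_nhds).eventually hH.eventually_analyticAt

theorem AnalyticAt.tendsto_leftEnd_exp {H : ℂ → ℂ} (hH : AnalyticAt ℂ H 0) :
    Tendsto (fun w => H (Complex.exp w)) leftEnd (𝓝 (H 0)) :=
  hH.continuousAt.tendsto.comp (tendsto_exp_leftEnd.mono_right nhdsWithin_le_nhds)

/-- The function on the `σ`-plane such that differentiation of `exp (r w) * H (exp w)` replaces
`H` by it. -/
noncomputable def expDeriv (r : ℂ) (H : ℂ → ℂ) : ℂ → ℂ := fun σ => r * H σ + σ * deriv H σ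

theorem analyticAt_expDeriv {r : ℂ} {H : ℂ → ℂ} (hH : AnalyticAt ℂ H 0) :
    AnalyticAt ℂ (expDeriv r H) 0 :=
  (analyticAt_const.mul hH).add (analyticAt_id.mul hH.deriv)

theorem expDeriv_zero (r : ℂ) (H : ℂ → ℂ) : expDeriv r H 0 = r * H 0 := by
  simp [expDeriv]

theorem eventually_deriv_eq_expDeriv {u H : ℂ → ℂ} {r : ℂ} (hH : AnalyticAt ℂ H 0)
    (hu : ∀ᶠ w in leftEnd, u w = Complex.exp (r * w) * H (Complex.exp w)) :
    ∀ᶠ w in leftEnd, deriv u w = Complex.exp (r * w) * expDeriv r H (Complex.exp w) := by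
  filter_upwards [hu.nhds_of_leftEnd, hH.eventually_leftEnd_exp] with w hw hA
  have h1 : HasDerivAt (fun w => Complex.exp (r * w)) (Complex.exp (r * w) * (r * 1)) w :=
    ((hasDerivAt_id w).const_mul r).cexp
  have h2 : HasDerivAt (fun w => H (Complex.exp w)) (deriv H (Complex.exp w) * Complex.exp w) w :=
    hA.differentiableAt.hasDerivAt.comp w (Complex.hasDerivAt_exp w)
  rw [EventuallyEq.deriv_eq hw, HasDerivAt.deriv (h1.fun_mul h2), expDeriv]
  ring

/-! ### Growth of solutions -/

theorem Filter.Tendsto.eventually_norm_le_add_one {l : Filter ℂ} {f : ℂ → ℂ} {a : ℂ}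
    (h : Tendsto f l (𝓝 a)) : ∀ᶠ w in l, ‖f w‖ ≤ ‖a‖ + 1 :=
  h.norm.eventually_le_const (by linarith)

namespace LinODE

theorem IsSolutionOn.differentiableAt {E : LinODE} {u : ℂ → ℂ} {R : ℝ}
    (h : E.IsSolutionOn u {w | w.re < R}) {w : ℂ} (hw : w.re < R) : DifferentiableAt ℂ u w :=
  h.1.differentiableAt ((isOpen_re_lt R).mem_nhds hw)

theorem IsSolutionOn.differentiableAt_deriv {E : LinODE} {u : ℂ → ℂ} {R : ℝ}
    (h : E.IsSolutionOn u {w | w.re < R}) {w : ℂ} (hw : w.re < R) :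
    DifferentiableAt ℂ (deriv u) w :=
  (h.1.deriv (isOpen_re_lt R)).differentiableAt ((isOpen_re_lt R).mem_nhds hw)

theorem IsSolutionOn.sub_const_mul {E : LinODE} {u v : ℂ → ℂ} {R : ℝ}
    (hu : E.IsSolutionOn u {w | w.re < R}) (hv : E.IsSolutionOn v {w | w.re < R}) (μ : ℂ) :
    E.IsSolutionOn (fun w => v w - μ * u w) {w | w.re < R} ∧
      ∀ w, w.re < R → deriv (fun w => v w - μ * u w) w = deriv v w - μ * deriv u w := by
  have hd : ∀ w, w.re < R → deriv (fun w => v w - μ * u w) w = deriv v w - μ * deriv u w :=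
    fun w hw => ((hv.differentiableAt hw).hasDerivAt.sub
      ((hu.differentiableAt hw).hasDerivAt.const_mul μ)).deriv
  refine ⟨⟨hv.1.sub (hu.1.const_mul μ), fun w hw => ?_⟩, hd⟩
  have hdd : deriv (deriv fun w => v w - μ * u w) w = deriv (deriv v) w - μ * deriv (deriv u) w := by
    have : deriv (fun w => v w - μ * u w) =ᶠ[𝓝 w] fun w => deriv v w - μ * deriv u w :=
      Filter.mem_of_superset ((isOpen_re_lt R).mem_nhds hw) hd
    rw [this.deriv_eq]
    exact ((hv.differentiableAt_deriv hw).hasDerivAt.sub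
      ((hu.differentiableAt_deriv hw).hasDerivAt.const_mul μ)).deriv
  rw [hdd, hd w hw]
  linear_combination hv.2 w hw - μ * hu.2 w hw

/-- Grönwall for the pair `(u, u')`, moving left along horizontal lines from the segment `Re w =
R₁`, `|Im w| ≤ π`. The coefficients are bounded near the left end because they converge there. This
moderate growth is what later excludes an essential singularity. -/
theorem IsSolutionOn.exists_norm_le {N : LinODE} {R : ℝ} {u : ℂ → ℂ} {α β : ℂ}
    (hf : Tendsto N.f leftEnd (𝓝 α)) (hg : Tendsto N.g leftEnd (𝓝 β))
    (hu : N.IsSolutionOn u {w | w.re < R}) :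
    ∃ R₁ < R, ∃ C K : ℝ, ∀ w : ℂ, w.re ≤ R₁ → |w.im| ≤ Real.pi →
      ‖u w‖ ≤ K * Real.exp (-(C * w.re)) := by
  obtain ⟨R₂, hR₂⟩ := eventually_leftEnd.1
    (hf.eventually_norm_le_add_one.and hg.eventually_norm_le_add_one)
  set A := ‖α‖ + 1 with hA
  set B := ‖β‖ + 1 with hB
  have hA0 : 0 ≤ A := by positivity
  have hB0 : 0 ≤ B := by positivity
  obtain ⟨R₁, hR₁R, hR₁R₂⟩ : ∃ R₁, R₁ < R ∧ R₁ < R₂ :=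
    ⟨min R R₂ - 1, by linarith [min_le_left R R₂], by linarith [min_le_right R R₂]⟩
  have hcont : ContinuousOn (fun y : ℝ => (u (R₁ + y * Complex.I), deriv u (R₁ + y * Complex.I)))
      (Set.Icc (-Real.pi) Real.pi) := by
    intro y _
    have hre : ((R₁ : ℂ) + y * Complex.I).re < R := by simpa using hR₁R
    have hc : ContinuousAt (fun y : ℝ => (R₁ : ℂ) + y * Complex.I) y := by fun_prop
    exact (ContinuousAt.prodMk
      (ContinuousAt.comp (f := fun y : ℝ => (R₁ : ℂ) + y * Complex.I) (g := u)
        (hu.differentiableAt hre).continuousAt hc)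
      (ContinuousAt.comp (f := fun y : ℝ => (R₁ : ℂ) + y * Complex.I) (g := deriv u)
        (hu.differentiableAt_deriv hre).continuousAt hc)).continuousWithinAt
  obtain ⟨K₀, hK₀⟩ := isCompact_Icc.exists_bound_of_continuousOn hcont
  refine ⟨R₁, hR₁R, 1 + A + B, K₀ * Real.exp ((1 + A + B) * R₁), fun w hw hwi => ?_⟩
  set Z : ℝ → ℂ := fun x => (R₁ - x : ℝ) + w.im * Complex.I with hZ
  have hZre : ∀ x, (Z x).re = R₁ - x := fun x => by simp [hZ]
  have hZd : ∀ x, HasDerivAt Z (-1) x := fun x => by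
    have h := (((hasDerivAt_id x).const_sub R₁).ofReal_comp).add_const ((w.im : ℂ) * Complex.I)
    simpa [hZ] using h
  have hy : ∀ x, 0 ≤ x → HasDerivAt (fun x => (u (Z x), deriv u (Z x)))
      (-deriv u (Z x), -deriv (deriv u) (Z x)) x := fun x hx => by
    have hre : (Z x).re < R := by rw [hZre]; linarith
    have h1 := (hu.differentiableAt hre).hasDerivAt.comp x (hZd x)
    have h2 := (hu.differentiableAt_deriv hre).hasDerivAt.comp x (hZd x)
    have := h1.prodMk h2
    simpa using this
  have key := norm_le_gronwallBound_of_norm_deriv_right_le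
    (f := fun x => (u (Z x), deriv u (Z x)))
    (f' := fun x => (-deriv u (Z x), -deriv (deriv u) (Z x)))
    (δ := K₀) (K := 1 + A + B) (ε := 0) (a := 0) (b := R₁ - w.re)
    (fun x hx => (hy x hx.1).continuousAt.continuousWithinAt)
    (fun x hx => (hy x hx.1).hasDerivWithinAt)
    (by simpa [hZ] using hK₀ w.im (abs_le.1 hwi))
    (fun x hx => by
      have hre : (Z x).re < R := by rw [hZre]; linarith [hx.1]
      obtain ⟨hfA, hgB⟩ := hR₂ (Z x) (by rw [hZre]; linarith [hx.1])
      have h1 : ‖u (Z x)‖ ≤ ‖(u (Z x), deriv u (Z x))‖ := norm_fst_le (u (Z x), deriv u (Z x))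
      have h2 : ‖deriv u (Z x)‖ ≤ ‖(u (Z x), deriv u (Z x))‖ :=
        norm_snd_le (u (Z x), deriv u (Z x))
      set n := ‖(u (Z x), deriv u (Z x))‖
      have hn : 0 ≤ n := norm_nonneg _
      have hdd : -deriv (deriv u) (Z x) = N.f (Z x) * deriv u (Z x) + N.g (Z x) * u (Z x) := by
        linear_combination -(hu.2 (Z x) hre)
      have h3 : ‖-deriv (deriv u) (Z x)‖ ≤ A * n + B * n := by
        rw [hdd]
        refine (norm_add_le _ _).trans (add_le_add ?_ ?_) <;> rw [norm_mul] <;> gcongr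
      rw [Prod.norm_def, add_zero]
      refine max_le ?_ ?_
      · rw [norm_neg]
        nlinarith [mul_nonneg hA0 hn, mul_nonneg hB0 hn]
      · nlinarith)
    (R₁ - w.re) ⟨by linarith, le_rfl⟩
  rw [gronwallBound_ε0, sub_zero] at key
  have hZw : Z (R₁ - w.re) = w := by
    simp [hZ, Complex.re_add_im]
  rw [hZw] at key
  calc ‖u w‖ ≤ ‖(u w, deriv u w)‖ := norm_fst_le (u w, deriv u w)
    _ ≤ _ := key
    _ = _ := by rw [mul_assoc, ← Real.exp_add]; ring_nf

/-! ### Solutions multiplied by a constant under the deck transformation -/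

theorem exists_exp_two_pi_I_mul_eq {c : ℂ} (hc : c ≠ 0) :
    ∃ ρ : ℂ, Complex.exp (2 * Real.pi * Complex.I * ρ) = c := by
  refine ⟨Complex.log c / (2 * Real.pi * Complex.I), ?_⟩
  rw [mul_div_cancel₀ _ Complex.two_pi_I_ne_zero, Complex.exp_log hc]

theorem eq_add_int_mul_of_periodic {U : ℂ → ℂ} {R : ℝ}
    (hper : ∀ w : ℂ, w.re < R → U (w + 2 * Real.pi * Complex.I) = U w) (n : ℤ) :
    ∀ w : ℂ, w.re < R → U (w + n * (2 * Real.pi * Complex.I)) = U w := by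
  induction n using Int.induction_on with
  | zero => simp
  | succ k ih =>
    intro w hw
    rw [← ih w hw, ← hper (w + (k : ℤ) * (2 * Real.pi * Complex.I)) (by simpa using hw)]
    congr 1
    push_cast
    ring
  | pred k ih =>
    intro w hw
    rw [← ih w hw, ← hper (w + ((-k - 1 : ℤ) : ℂ) * (2 * Real.pi * Complex.I)) (by simpa using hw)]
    congr 1
    push_cast
    ring

/-- A periodic holomorphic function of at most exponential growth on a left half-plane is, up to an
exponential factor, an analytic function of `exp w`. -/
theorem exists_analyticAt_of_periodic {U : ℂ → ℂ} {R C K : ℝ}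
    (hd : ∀ w : ℂ, w.re < R → DifferentiableAt ℂ U w)
    (hper : ∀ w : ℂ, w.re < R → U (w + 2 * Real.pi * Complex.I) = U w)
    (hU : ∀ w : ℂ, w.re < R → |w.im| ≤ Real.pi → ‖U w‖ ≤ K * Real.exp (-(C * w.re))) :
    ∃ (m : ℕ) (H : ℂ → ℂ), AnalyticAt ℂ H 0 ∧
      ∀ᶠ w in leftEnd, Complex.exp w ^ m * U w = H (Complex.exp w) := by
  -- With `m ≥ C + 1` and `‖σ‖ < 1`, `‖σ ^ m * U (log σ)‖ ≤ |K| * ‖σ‖`, so the value 0 at the origin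
  -- removes the singularity. The `0` in `min R 0` below ensures `‖σ‖ < 1`.
  obtain ⟨m, hm⟩ := exists_nat_ge (C + 1)
  have hexp : ∀ w : ℂ, w.re < R → U (Complex.log (Complex.exp w)) = U w := fun w hw => by
    obtain ⟨n, hn⟩ := Complex.exp_eq_exp_iff_exists_int.1 (Complex.exp_log (Complex.exp_ne_zero w))
    rw [hn]
    exact eq_add_int_mul_of_periodic hper n w hw
  have hlog : ∀ᶠ σ in 𝓝[≠] (0 : ℂ), σ ≠ 0 ∧ (Complex.log σ).re < min R 0 := by
    have hball : ∀ᶠ σ in 𝓝[≠] (0 : ℂ), ‖σ‖ < Real.exp (min R 0) :=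
      nhdsWithin_le_nhds (by
        simpa [Metric.ball, dist_zero_right] using
          Metric.ball_mem_nhds (0 : ℂ) (Real.exp_pos (min R 0)))
    filter_upwards [self_mem_nhdsWithin, hball] with σ hσ hlt
    refine ⟨hσ, ?_⟩
    rw [Complex.log_re]
    exact (Real.log_lt_iff_lt_exp (norm_pos_iff.2 hσ)).2 hlt
  refine ⟨m, fun σ => if σ = 0 then 0 else σ ^ m * U (Complex.log σ), ?_, ?_⟩
  · refine Complex.analyticAt_of_differentiable_on_punctured_nhds_of_continuousAt ?_ ?_
    · filter_upwards [hlog] with σ₀ ⟨hσ, hre⟩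
      have hre' := hre.trans_le (min_le_left _ _)
      -- A branch of the logarithm holomorphic near `σ₀`, even on the cut of the principal branch;
      -- periodicity makes `U` insensitive to the branch.
      set G : ℂ → ℂ := fun σ => Complex.log (σ / σ₀) + Complex.log σ₀ with hG
      have hG1 : DifferentiableAt ℂ G σ₀ := by
        refine DifferentiableAt.add_const _ (DifferentiableAt.clog (by fun_prop) ?_)
        rw [div_self hσ]
        exact Complex.one_mem_slitPlane
      have hG0 : G σ₀ = Complex.log σ₀ := by simp [hG, div_self hσ]
      have hd1 : DifferentiableAt ℂ (fun σ => σ ^ m * U (G σ)) σ₀ := by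
        refine DifferentiableAt.mul (by fun_prop) (DifferentiableAt.comp σ₀ ?_ hG1)
        rw [hG0]
        exact hd _ hre'
      refine hd1.congr_of_eventuallyEq ?_
      have hev : ∀ᶠ σ in 𝓝 σ₀, (G σ).re < R :=
        (Complex.continuous_re.continuousAt.comp hG1.continuousAt).eventually_lt_const
          (by simpa [hG0] using hre')
      filter_upwards [hev, isOpen_ne.mem_nhds hσ] with σ h1 h2
      have h2' : σ ≠ 0 := h2
      rw [if_neg h2', ← hexp (G σ) h1]
      have : Complex.exp (G σ) = σ := by
        rw [hG, Complex.exp_add, Complex.exp_log (div_ne_zero h2' hσ), Complex.exp_log hσ,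
          div_mul_cancel₀ _ hσ]
      rw [this]
    · rw [continuousAt_iff_punctured_nhds, if_pos rfl]
      refine squeeze_zero_norm' (a := fun σ => |K| * ‖σ‖) ?_ ?_
      · filter_upwards [hlog] with σ ⟨hσ, hre⟩
        have hx := hre.trans_le (min_le_right _ _)
        rw [if_neg hσ, norm_mul, norm_pow]
        have hs : ‖σ‖ = Real.exp (Complex.log σ).re := by
          rw [← Complex.norm_exp, Complex.exp_log hσ]
        have hb := hU (Complex.log σ) (hre.trans_le (min_le_left _ _))
          (by rw [Complex.log_im]; exact Complex.abs_arg_le_pi σ)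
        rw [hs, ← Real.exp_nat_mul]
        calc _ ≤ Real.exp (m * (Complex.log σ).re) *
              (|K| * Real.exp (-(C * (Complex.log σ).re))) := by
              gcongr
              exact hb.trans (by gcongr; exact le_abs_self K)
          _ = |K| * Real.exp (m * (Complex.log σ).re + -(C * (Complex.log σ).re)) := by
              rw [Real.exp_add]; ring
          _ ≤ |K| * Real.exp (Complex.log σ).re := by
              gcongr
              nlinarith
      · have : Tendsto (fun σ : ℂ => |K| * ‖σ‖) (𝓝 0) (𝓝 (|K| * ‖(0 : ℂ)‖)) :=
          (continuous_const.mul continuous_norm).tendsto 0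
        simpa using this.mono_left nhdsWithin_le_nhds
  · exact eventually_leftEnd.2 ⟨R, fun w hw => by
      simp only [if_neg (Complex.exp_ne_zero w), hexp w hw]⟩

/-- For `c = exp (2πiρ)`, the function `exp (-ρ w) * u w` is periodic and of exponential growth, so
it descends to a function of `exp w` with at most a pole. Shifting `ρ` by the integer `m` absorbs
the pole and keeps the multiplier. -/
theorem IsSolutionOn.exists_exp_mul_analyticAt {N : LinODE} {R : ℝ} {u : ℂ → ℂ} {α β c : ℂ}
    (hf : Tendsto N.f leftEnd (𝓝 α)) (hg : Tendsto N.g leftEnd (𝓝 β))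
    (hu : N.IsSolutionOn u {w | w.re < R}) (hc : c ≠ 0)
    (hper : ∀ w : ℂ, w.re < R → u (w + 2 * Real.pi * Complex.I) = c * u w) :
    ∃ (r : ℂ) (H : ℂ → ℂ), Complex.exp (2 * Real.pi * Complex.I * r) = c ∧ AnalyticAt ℂ H 0 ∧
      ∀ᶠ w in leftEnd, u w = Complex.exp (r * w) * H (Complex.exp w) := by
  obtain ⟨ρ, hρ⟩ := exists_exp_two_pi_I_mul_eq hc
  obtain ⟨R₁, hR₁, C, K, hb⟩ := hu.exists_norm_le hf hg
  obtain ⟨m, H, hH, hev⟩ := exists_analyticAt_of_periodic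
    (U := fun w => Complex.exp (-(ρ * w)) * u w) (R := R₁) (C := C + ρ.re)
    (K := |K| * Real.exp (|ρ.im| * Real.pi))
    (fun w hw => DifferentiableAt.mul (by fun_prop) (hu.differentiableAt (hw.trans hR₁)))
    (fun w hw => by
      have : Complex.exp (-(ρ * (w + 2 * Real.pi * Complex.I))) * c = Complex.exp (-(ρ * w)) := by
        rw [← hρ, ← Complex.exp_add]
        ring_nf
      rw [hper w (hw.trans hR₁), ← mul_assoc, this])
    (fun w hw hi => by
      rw [norm_mul, Complex.norm_exp]
      have h1 : (-(ρ * w)).re ≤ -(ρ.re * w.re) + |ρ.im| * Real.pi := by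
        have : ρ.im * w.im ≤ |ρ.im| * Real.pi :=
          (le_abs_self _).trans (by rw [abs_mul]; gcongr)
        simp only [Complex.neg_re, Complex.mul_re]
        linarith
      have h2 : ‖u w‖ ≤ |K| * Real.exp (-(C * w.re)) :=
        (hb w hw.le hi).trans (by gcongr; exact le_abs_self K)
      calc _ ≤ Real.exp (-(ρ.re * w.re) + |ρ.im| * Real.pi) *
            (|K| * Real.exp (-(C * w.re))) := by gcongr
        _ = _ := by
          rw [Real.exp_add, show -((C + ρ.re) * w.re) = -(ρ.re * w.re) + -(C * w.re) by ring,
            Real.exp_add]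
          ring)
  refine ⟨ρ - m, H, ?_, hH, ?_⟩
  · rw [mul_sub, Complex.exp_sub, hρ, mul_comm _ (m : ℂ), Complex.exp_nat_mul_two_pi_mul_I, div_one]
  · filter_upwards [hev] with w hw
    rw [← hw, ← Complex.exp_nat_mul, ← mul_assoc, ← mul_assoc, ← Complex.exp_add, ← Complex.exp_add]
    ring_nf
    simp

/-- The order of vanishing of the analytic factor is moved into the exponent, so that `H 0 ≠ 0`.
Dividing the equation by `exp (r w)` and letting `Re w → -∞` leaves `(r ^ 2 + α r + β) * H 0 = 0`.
-/
theorem IsSolutionOn.exists_indicial_root {N : LinODE} {R : ℝ} {u : ℂ → ℂ} {α β c : ℂ}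
    (hf : Tendsto N.f leftEnd (𝓝 α)) (hg : Tendsto N.g leftEnd (𝓝 β))
    (hu : N.IsSolutionOn u {w | w.re < R}) (hc : c ≠ 0)
    (hper : ∀ w : ℂ, w.re < R → u (w + 2 * Real.pi * Complex.I) = c * u w)
    (hne : ∀ w : ℂ, w.re < R → u w ≠ 0 ∨ deriv u w ≠ 0) :
    ∃ (r : ℂ) (H : ℂ → ℂ), Complex.exp (2 * Real.pi * Complex.I * r) = c ∧
      r ^ 2 + α * r + β = 0 ∧ AnalyticAt ℂ H 0 ∧ H 0 ≠ 0 ∧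
      ∀ᶠ w in leftEnd, u w = Complex.exp (r * w) * H (Complex.exp w) := by
  obtain ⟨r₀, H₀, hr₀, hH₀, hu₀⟩ := hu.exists_exp_mul_analyticAt hf hg hc hper
  have hR : ∀ᶠ w in leftEnd, w.re < R := eventually_leftEnd.2 ⟨R, fun _ h => h⟩
  have hnz : ¬ ∀ᶠ σ in 𝓝 (0 : ℂ), H₀ σ = 0 := by
    intro h0
    have hz : ∀ᶠ w in leftEnd, u w = 0 := by
      filter_upwards [hu₀, (tendsto_exp_leftEnd.mono_right nhdsWithin_le_nhds).eventually h0]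
        with w h1 h2
      rw [h1, h2, mul_zero]
    obtain ⟨w, hw, hwR⟩ := (hz.nhds_of_leftEnd.and hR).exists
    rcases hne w hwR with h | h
    · exact h hw.self_of_nhds
    · exact h (by rw [EventuallyEq.deriv_eq (f := fun _ => 0) hw, deriv_const])
  obtain ⟨n, H, hH, hH0, hn⟩ := hH₀.exists_eventuallyEq_pow_smul_nonzero_iff.2 hnz
  have hu1 : ∀ᶠ w in leftEnd, u w = Complex.exp ((r₀ + n) * w) * H (Complex.exp w) := by
    filter_upwards [hu₀, (tendsto_exp_leftEnd.mono_right nhdsWithin_le_nhds).eventually hn]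
      with w h1 h2
    rw [h1, h2, add_mul, Complex.exp_add, Complex.exp_nat_mul, sub_zero, smul_eq_mul, mul_assoc]
  have hu2 := eventually_deriv_eq_expDeriv hH hu1
  have hu3 := eventually_deriv_eq_expDeriv (analyticAt_expDeriv hH) hu2
  refine ⟨r₀ + n, H, ?_, ?_, hH, hH0, hu1⟩
  · rw [mul_add, Complex.exp_add, hr₀, mul_comm _ (n : ℂ), Complex.exp_nat_mul_two_pi_mul_I,
      mul_one]
  · set r := r₀ + n
    have hlim := (((analyticAt_expDeriv (r := r) (analyticAt_expDeriv (r := r) hH)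
      ).tendsto_leftEnd_exp).add
      (hf.mul (analyticAt_expDeriv (r := r) hH).tendsto_leftEnd_exp)).add
      (hg.mul hH.tendsto_leftEnd_exp)
    have hzero : ∀ᶠ w in leftEnd, expDeriv r (expDeriv r H) (Complex.exp w) +
        N.f w * expDeriv r H (Complex.exp w) + N.g w * H (Complex.exp w) = 0 := by
      filter_upwards [hu1, hu2, hu3, hR] with w h1 h2 h3 hw
      have h := hu.2 w hw
      rw [h1, h2, h3] at h
      refine (mul_eq_zero.1 ?_).resolve_left (Complex.exp_ne_zero (r * w))
      linear_combination h
    have h0 := tendsto_nhds_unique (hlim.congr' hzero) tendsto_const_nhds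
    rw [expDeriv_zero, expDeriv_zero] at h0
    refine (mul_eq_zero.1 ?_).resolve_right hH0
    linear_combination h0

/-- If the monodromy of an equation with asymptotically constant coefficients is scalar, then the
difference of the two roots of the characteristic equation is a nonzero integer. -/
theorem exists_int_sq_eq_discrim {N : LinODE} {R : ℝ} {u v : ℂ → ℂ} {α β c : ℂ}
    (hf : Tendsto N.f leftEnd (𝓝 α)) (hg : Tendsto N.g leftEnd (𝓝 β))
    (hu : N.IsSolutionOn u {w | w.re < R}) (hv : N.IsSolutionOn v {w | w.re < R})
    (hW : ∀ w : ℂ, w.re < R → u w * deriv v w - deriv u w * v w ≠ 0)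
    (hper : ∀ w : ℂ, w.re < R →
      u (w + 2 * Real.pi * Complex.I) = c * u w ∧ v (w + 2 * Real.pi * Complex.I) = c * v w) :
    ∃ n : ℤ, n ≠ 0 ∧ α ^ 2 - 4 * β = (n : ℂ) ^ 2 := by
  -- The half-plane is stable under `w ↦ w - 2πi`, so `c = 0` would make `u` and `v` vanish
  -- identically.
  have hc : c ≠ 0 := by
    rintro rfl
    have hz : ∀ w : ℂ, w.re < R → u w = 0 ∧ v w = 0 := fun w hw => by
      have := hper (w - 2 * Real.pi * Complex.I) (by simpa using hw)
      simpa using this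
    have hw : ((R - 1 : ℝ) : ℂ).re < R := by simp
    exact hW _ hw (by rw [(hz _ hw).1, (hz _ hw).2]; ring)
  have main : ∀ (r₁ r₂ : ℂ), r₁ ≠ r₂ → Complex.exp (2 * Real.pi * Complex.I * r₁) = c →
      Complex.exp (2 * Real.pi * Complex.I * r₂) = c → r₁ ^ 2 + α * r₁ + β = 0 →
      r₂ ^ 2 + α * r₂ + β = 0 → ∃ n : ℤ, n ≠ 0 ∧ α ^ 2 - 4 * β = (n : ℂ) ^ 2 := by
    intro r₁ r₂ hne e₁ e₂ q₁ q₂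
    obtain ⟨n, hn⟩ := Complex.exp_eq_exp_iff_exists_int.1 (e₁.trans e₂.symm)
    have hn' : r₁ = r₂ + n := by
      apply mul_left_cancel₀ Complex.two_pi_I_ne_zero
      linear_combination hn
    refine ⟨n, ?_, ?_⟩
    · rintro rfl
      exact hne (by simpa using hn')
    · have hα : r₁ + r₂ + α = 0 := by
        apply (mul_eq_zero.1 _).resolve_left (sub_ne_zero.2 hne)
        linear_combination q₁ - q₂
      have : (n : ℂ) = r₁ - r₂ := by rw [hn']; ring
      rw [this]
      linear_combination (α - r₁ - r₂) * hα - 4 * q₁ + 4 * r₁ * hα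
  obtain ⟨r₁, H₁, e₁, q₁, hH₁, hH₁0, hu₁⟩ := hu.exists_indicial_root hf hg hc
    (fun w hw => (hper w hw).1) (fun w hw => by
      by_contra! h
      exact hW w hw (by simp [h]))
  obtain ⟨r₂, H₂, e₂, q₂, hH₂, hH₂0, hv₂⟩ := hv.exists_indicial_root hf hg hc
    (fun w hw => (hper w hw).2) (fun w hw => by
      by_contra! h
      exact hW w hw (by simp [h]))
  rcases ne_or_eq r₁ r₂ with hne | rfl
  · exact main r₁ r₂ hne e₁ e₂ q₁ q₂
  -- If `u` and `v` share an exponent, `v - μ u` cancels their leading terms. Were its exponent also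
  -- the same, its factor `H₃` would vanish at 0, contrary to the normalization.
  set μ := H₂ 0 / H₁ 0 with hμ
  obtain ⟨hx, hxd⟩ := hu.sub_const_mul hv μ
  obtain ⟨r₃, H₃, e₃, q₃, hH₃, hH₃0, hx₃⟩ := hx.exists_indicial_root hf hg hc
    (fun w hw => by simp only [(hper w hw).1, (hper w hw).2]; ring) (fun w hw => by
      by_contra! h
      rw [hxd w hw] at h
      obtain ⟨ha, hb⟩ := h
      exact hW w hw (by linear_combination u w * hb - deriv u w * ha))
  rcases ne_or_eq r₁ r₃ with hne | rfl
  · exact main r₁ r₃ hne e₁ e₃ q₁ q₃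
  exfalso
  have hlim := hH₂.tendsto_leftEnd_exp.sub (hH₁.tendsto_leftEnd_exp.const_mul μ)
  have heq : ∀ᶠ w in leftEnd,
      H₂ (Complex.exp w) - μ * H₁ (Complex.exp w) = H₃ (Complex.exp w) := by
    filter_upwards [hu₁, hv₂, hx₃] with w h1 h2 h3
    rw [h1, h2] at h3
    apply mul_left_cancel₀ (Complex.exp_ne_zero (r₁ * w))
    linear_combination h3
  have h0 := tendsto_nhds_unique (hlim.congr' heq) hH₃.tendsto_leftEnd_exp
  rw [hμ, div_mul_cancel₀ _ hH₁0, sub_self] at h0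
  exact hH₃0 h0.symm

end LinODE

/-! ### Pull-backs under compositions -/

namespace LinODE

theorem pullback_congr {E : LinODE} {ψ χ : ℂ → ℂ} {w : ℂ} (h : ψ =ᶠ[𝓝 w] χ) :
    (E.pullback ψ).f w = (E.pullback χ).f w ∧ (E.pullback ψ).g w = (E.pullback χ).g w := by
  simp only [pullback, h.eq_of_nhds, h.deriv_eq, h.deriv.deriv_eq, and_self]

theorem pullback_pullback {E : LinODE} {ψ χ : ℂ → ℂ} {w : ℂ} (hψ : AnalyticAt ℂ ψ (χ w))
    (hχ : AnalyticAt ℂ χ w) (hψ' : deriv ψ (χ w) ≠ 0) (hχ' : deriv χ w ≠ 0) :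
    ((E.pullback ψ).pullback χ).f w = (E.pullback (ψ ∘ χ)).f w ∧
      ((E.pullback ψ).pullback χ).g w = (E.pullback (ψ ∘ χ)).g w := by
  have h1 : deriv (ψ ∘ χ) w = deriv ψ (χ w) * deriv χ w :=
    deriv_comp w hψ.differentiableAt hχ.differentiableAt
  have h2 : deriv (deriv (ψ ∘ χ)) w =
      deriv (deriv ψ) (χ w) * deriv χ w * deriv χ w + deriv ψ (χ w) * deriv (deriv χ) w := by
    have hev : deriv (ψ ∘ χ) =ᶠ[𝓝 w] fun w => deriv ψ (χ w) * deriv χ w := by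
      filter_upwards [hχ.continuousAt.eventually hψ.eventually_analyticAt,
        hχ.eventually_analyticAt] with z hz1 hz2
      exact deriv_comp z hz1.differentiableAt hz2.differentiableAt
    rw [hev.deriv_eq]
    exact ((hψ.deriv.differentiableAt.hasDerivAt.comp w hχ.differentiableAt.hasDerivAt).mul
      hχ.deriv.differentiableAt.hasDerivAt).deriv
  simp only [pullback, h1, h2, Function.comp_apply]
  constructor
  · field_simp
    ring
  · ring

end LinODE

theorem analyticAt_localParam (t : OnePoint ℂ) {s : ℂ} (hs : s ≠ 0) :
    AnalyticAt ℂ (localParam t) s := by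
  cases t with
  | infty => exact analyticAt_inv hs
  | coe t => exact analyticAt_const.add analyticAt_id

theorem deriv_localParam_ne_zero (t : OnePoint ℂ) {s : ℂ} (hs : s ≠ 0) :
    deriv (localParam t) s ≠ 0 := by
  cases t with
  | infty =>
    change deriv (fun s : ℂ => s⁻¹) s ≠ 0
    rw [deriv_inv]
    exact neg_ne_zero.2 (inv_ne_zero (pow_ne_zero 2 hs))
  | coe t =>
    change deriv (fun s : ℂ => t + s) s ≠ 0
    simp

namespace LinODE

/-- Both `ψ' / ψ` and `ψ'' / ψ'` tend to `e`. The coefficients are `(ψ f(ψ)) (ψ' / ψ) - ψ'' / ψ'`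
and `(ψ² g(ψ)) (ψ' / ψ)²`, which gives the limits. -/
theorem tendsto_pullback_leftEnd {N : LinODE} {a b : ℂ} {e : ℕ} (he : e ≠ 0) {k : ℂ → ℂ}
    (hf : Tendsto (fun s => s * N.f s) (𝓝[≠] 0) (𝓝 a))
    (hg : Tendsto (fun s => s ^ 2 * N.g s) (𝓝[≠] 0) (𝓝 b))
    (hk : AnalyticAt ℂ k 0) (hk0 : k 0 ≠ 0) {ψ : ℂ → ℂ}
    (hψ : ψ = fun w => Complex.exp (e * w) * k (Complex.exp w)) :
    Tendsto (N.pullback ψ).f leftEnd (𝓝 (e * (a - 1))) ∧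
      Tendsto (N.pullback ψ).g leftEnd (𝓝 (e ^ 2 * b)) ∧
      ∀ᶠ w in leftEnd, AnalyticAt ℂ ψ w ∧ ψ w ≠ 0 ∧ deriv ψ w ≠ 0 := by
  have he' : (e : ℂ) ≠ 0 := Nat.cast_ne_zero.2 he
  set k₁ := expDeriv e k with hk₁
  set k₂ := expDeriv e k₁ with hk₂
  have hk₁A : AnalyticAt ℂ k₁ 0 := analyticAt_expDeriv hk
  have hk₂A : AnalyticAt ℂ k₂ 0 := analyticAt_expDeriv hk₁A
  have hk₁z : k₁ 0 = e * k 0 := expDeriv_zero _ _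
  have hk₂z : k₂ 0 = e * (e * k 0) := by rw [hk₂, expDeriv_zero, hk₁z]
  have hk₁0 : k₁ 0 ≠ 0 := hk₁z ▸ mul_ne_zero he' hk0
  have h0 : ∀ w, ψ w = Complex.exp (e * w) * k (Complex.exp w) := fun w => by rw [hψ]
  have h1 : ∀ᶠ w in leftEnd, deriv ψ w = Complex.exp (e * w) * k₁ (Complex.exp w) :=
    eventually_deriv_eq_expDeriv hk (Eventually.of_forall h0)
  have h2 : ∀ᶠ w in leftEnd, deriv (deriv ψ) w = Complex.exp (e * w) * k₂ (Complex.exp w) :=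
    eventually_deriv_eq_expDeriv hk₁A h1
  have hkne : ∀ᶠ w in leftEnd, k (Complex.exp w) ≠ 0 :=
    hk.tendsto_leftEnd_exp.eventually_ne hk0
  have hk₁ne : ∀ᶠ w in leftEnd, k₁ (Complex.exp w) ≠ 0 :=
    hk₁A.tendsto_leftEnd_exp.eventually_ne hk₁0
  have hψne : ∀ᶠ w in leftEnd, ψ w ≠ 0 := by
    filter_upwards [hkne] with w hw
    rw [h0]
    exact mul_ne_zero (Complex.exp_ne_zero _) hw
  have hψ0 : Tendsto ψ leftEnd (𝓝[≠] 0) := by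
    refine tendsto_nhdsWithin_iff.2 ⟨?_, hψne⟩
    have := ((tendsto_exp_leftEnd.mono_right nhdsWithin_le_nhds).pow e).mul hk.tendsto_leftEnd_exp
    rw [zero_pow he, zero_mul] at this
    refine this.congr fun w => ?_
    rw [h0, Complex.exp_nat_mul]
  have hq₁ : Tendsto (fun w => k₁ (Complex.exp w) / k (Complex.exp w)) leftEnd (𝓝 (e : ℂ)) := by
    have := hk₁A.tendsto_leftEnd_exp.div hk.tendsto_leftEnd_exp hk0
    rwa [hk₁z, mul_div_cancel_right₀ _ hk0] at this
  have hq₂ : Tendsto (fun w => k₂ (Complex.exp w) / k₁ (Complex.exp w)) leftEnd (𝓝 (e : ℂ)) := by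
    have := hk₂A.tendsto_leftEnd_exp.div hk₁A.tendsto_leftEnd_exp hk₁0
    rwa [hk₂z, hk₁z, mul_div_cancel_right₀ _ (mul_ne_zero he' hk0)] at this
  refine ⟨?_, ?_, ?_⟩
  · have := ((hf.comp hψ0).mul hq₁).sub hq₂
    rw [show a * (e : ℂ) - e = e * (a - 1) by ring] at this
    refine this.congr' ?_
    filter_upwards [h1, h2, hkne, hk₁ne] with w e1 e2 n n₁
    simp only [pullback, Function.comp_apply, e1, e2]
    rw [mul_div_mul_left _ _ (Complex.exp_ne_zero _), h0 w]
    field_simp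
  · have := (hg.comp hψ0).mul (hq₁.pow 2)
    rw [mul_comm b] at this
    refine this.congr' ?_
    filter_upwards [h1, hkne] with w e1 n
    simp only [pullback, Function.comp_apply, e1]
    rw [h0 w]
    field_simp
  · filter_upwards [h1, hψne, hk₁ne, hk.eventually_leftEnd_exp] with w e1 n n₁ hA
    refine ⟨?_, n, e1 ▸ mul_ne_zero (Complex.exp_ne_zero _) n₁⟩
    rw [hψ]
    exact AnalyticAt.mul (by fun_prop) (AnalyticAt.comp hA (by fun_prop))

/-- If a map `F` sends a point `t` to a point `p` of exponent `θ` with multiplicity `e`, and the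
pull-back under `F` has trivial projective monodromy at `t`, then `e θ` is a nonzero integer. -/
theorem HasExponentAt.exists_int_of_hasTrivialMonodromyAt {E : LinODE} {p t : OnePoint ℂ} {θ : ℂ}
    (hE : E.HasExponentAt p θ) {F : ℂ → ℂ} {e : ℕ} (he : e ≠ 0) {k : ℂ → ℂ}
    (hk : AnalyticAt ℂ k 0) (hk0 : k 0 ≠ 0)
    (hFA : ∀ᶠ σ in 𝓝[≠] 0, AnalyticAt ℂ F (localParam t σ))
    (hF : ∀ᶠ σ in 𝓝[≠] 0, F (localParam t σ) = localParam p (σ ^ e * k σ))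
    (htriv : (E.pullback F).HasTrivialMonodromyAt t) :
    ∃ n : ℤ, n ≠ 0 ∧ ((e : ℂ) * θ) ^ 2 = (n : ℂ) ^ 2 := by
  obtain ⟨a, b, ha, hb, hθ⟩ := hE
  obtain ⟨R, u, v, c, hu, hv, hW, hper⟩ := htriv
  set ψ : ℂ → ℂ := fun w => Complex.exp (e * w) * k (Complex.exp w) with hψ
  set χ : ℂ → ℂ := fun w => localParam t (Complex.exp w) with hχ
  obtain ⟨hlf, hlg, hψp⟩ := tendsto_pullback_leftEnd he ha hb hk hk0 hψ
  have hcomp : ∀ᶠ w in leftEnd, F (χ w) = localParam p (ψ w) := by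
    filter_upwards [tendsto_exp_leftEnd.eventually hF] with w hw
    rw [hχ, hψ]
    simp only [hw, Complex.exp_nat_mul]
  -- `F ∘ χ` and `localParam p ∘ ψ` are the same map near the left end; pulling back in stages along
  -- either factorization gives the same equation.
  have heq : ∀ᶠ w in leftEnd,
      ((E.pullback (localParam p)).pullback ψ).f w = ((E.pullback F).pullback χ).f w ∧
      ((E.pullback (localParam p)).pullback ψ).g w = ((E.pullback F).pullback χ).g w := by
    filter_upwards [hcomp.nhds_of_leftEnd, hψp, tendsto_exp_leftEnd.eventually hFA]
      with w hev ⟨hψA, hψ0, hψ'⟩ hFw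
    have hlA := analyticAt_localParam t (Complex.exp_ne_zero w)
    have hχA : AnalyticAt ℂ χ w := AnalyticAt.comp hlA (by fun_prop)
    have hχ' : deriv χ w ≠ 0 := by
      have : deriv χ w = deriv (localParam t) (Complex.exp w) * Complex.exp w :=
        (hlA.differentiableAt.hasDerivAt.comp w (Complex.hasDerivAt_exp w)).deriv
      rw [this]
      exact mul_ne_zero (deriv_localParam_ne_zero t (Complex.exp_ne_zero w)) (Complex.exp_ne_zero w)
    have hpA := analyticAt_localParam p hψ0
    have hp' := deriv_localParam_ne_zero p hψ0
    have hev' : F ∘ χ =ᶠ[𝓝 w] localParam p ∘ ψ := hev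
    -- `pullback` divides by the derivative, so composing pull-backs needs this; it follows from the
    -- chain rule, the other factorization having nonzero derivative.
    have hF' : deriv F (χ w) ≠ 0 := by
      have h := hev'.deriv_eq
      rw [deriv_comp w hFw.differentiableAt hχA.differentiableAt,
        deriv_comp w hpA.differentiableAt hψA.differentiableAt] at h
      intro h0
      rw [h0, zero_mul] at h
      exact mul_ne_zero hp' hψ' h.symm
    have e1 := pullback_pullback (E := E) (χ := χ) hFw hχA hF' hχ'
    have e2 := pullback_pullback (E := E) hpA hψA hp' hψ'
    have e3 := pullback_congr (E := E) hev'
    exact ⟨e2.1.trans (e3.1.symm.trans e1.1.symm), e2.2.trans (e3.2.symm.trans e1.2.symm)⟩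
  obtain ⟨n, hn, hsq⟩ := exists_int_sq_eq_discrim (hlf.congr' (heq.mono fun _ h => h.1))
    (hlg.congr' (heq.mono fun _ h => h.2)) hu hv hW hper
  exact ⟨n, hn, by rw [← hsq, mul_pow, hθ]; ring⟩

end LinODE

/-! ### Binary forms of degree `d` on the sphere -/

section BinaryForms

open Polynomial

/-- The multiplicity at a point of the sphere of a polynomial considered as a binary form of
degree `d`. -/
noncomputable def formMult (d : ℕ) (R : ℂ[X]) : OnePoint ℂ → ℕ
  | none => d - R.natDegree
  | some t => R.rootMultiplicity t

/-- The value at a point of the sphere of a polynomial considered as a binary form of degree `d`. -/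
noncomputable def formEval (d : ℕ) (R : ℂ[X]) : OnePoint ℂ → ℂ
  | none => R.coeff d
  | some t => R.eval t

/-- The set of zeros on the sphere of a polynomial considered as a binary form of degree `d`. -/
noncomputable def formZeros (d : ℕ) (R : ℂ[X]) : Finset (OnePoint ℂ) :=
  open Classical in
  R.roots.toFinset.image ((↑) : ℂ → OnePoint ℂ) ∪
    if R.natDegree < d then {OnePoint.infty} else ∅

variable {d : ℕ} {R S : ℂ[X]}

theorem formMult_ne_zero_iff (hR : R ≠ 0) (hd : R.natDegree ≤ d) (t : OnePoint ℂ) :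
    formMult d R t ≠ 0 ↔ formEval d R t = 0 := by
  cases t with
  | infty =>
    change d - R.natDegree ≠ 0 ↔ R.coeff d = 0
    constructor
    · intro h
      exact coeff_eq_zero_of_natDegree_lt (by omega)
    · intro h h'
      have hdd : R.natDegree = d := by omega
      rw [← hdd] at h
      exact hR (leadingCoeff_eq_zero.1 h)
  | coe t =>
    change R.rootMultiplicity t ≠ 0 ↔ R.eval t = 0
    rw [← pos_iff_ne_zero, rootMultiplicity_pos hR, IsRoot.def]

theorem mem_formZeros_iff (hR : R ≠ 0) (t : OnePoint ℂ) :
    t ∈ formZeros d R ↔ formMult d R t ≠ 0 := by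
  classical
  cases t with
  | infty =>
    change OnePoint.infty ∈ formZeros d R ↔ d - R.natDegree ≠ 0
    rw [formZeros]
    split_ifs with h
    · simp only [Finset.mem_union, Finset.mem_singleton, or_true, true_iff]
      omega
    · simp
      omega
  | coe t =>
    change (t : OnePoint ℂ) ∈ formZeros d R ↔ R.rootMultiplicity t ≠ 0
    rw [← pos_iff_ne_zero, rootMultiplicity_pos hR, formZeros]
    split_ifs with h <;> simp [hR]

theorem sum_formMult_formZeros (hd : R.natDegree ≤ d) :
    ∑ t ∈ formZeros d R, formMult d R t = d := by
  classical
  have h1 : ∑ t ∈ R.roots.toFinset.image ((↑) : ℂ → OnePoint ℂ), formMult d R t = R.natDegree := by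
    rw [Finset.sum_image OnePoint.coe_injective.injOn,
      ← splits_iff_card_roots.1 (IsAlgClosed.splits R), ← Multiset.toFinset_sum_count_eq]
    exact Finset.sum_congr rfl fun t _ => (count_roots R).symm
  rw [formZeros, Finset.sum_union, h1]
  · split_ifs with h
    · rw [Finset.sum_singleton]
      change R.natDegree + (d - R.natDegree) = d
      omega
    · rw [Finset.sum_empty]
      omega
  · split_ifs with h <;> simp

theorem sum_formMult_le (hR : R ≠ 0) (hd : R.natDegree ≤ d) (T : Finset (OnePoint ℂ)) :
    ∑ t ∈ T, formMult d R t ≤ d := by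
  classical
  rw [← Finset.sum_filter_ne_zero]
  conv_rhs => rw [← sum_formMult_formZeros hd]
  refine Finset.sum_le_sum_of_subset fun t ht => ?_
  exact (mem_formZeros_iff hR t).2 (Finset.mem_filter.1 ht).2

/-- The general bound `deg R + deg S - 1` is one too large when both degrees equal `d`. Subtracting
a multiple of `R` from `S` then lowers the degree of `S` without changing the Wronskian. -/
theorem natDegree_wronskian_le (hR : R.natDegree ≤ d) (hS : S.natDegree ≤ d)
    (hW : wronskian R S ≠ 0) : (wronskian R S).natDegree ≤ 2 * d - 2 := by
  have hlt := natDegree_wronskian_lt_add hW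
  by_cases h : R.natDegree < d ∨ S.natDegree < d
  · omega
  have hRd : R.natDegree = d := by omega
  have hSd : S.natDegree = d := by omega
  have hR0 : R ≠ 0 := by
    rintro rfl
    exact hW (wronskian_zero_left S)
  have hc : R.coeff d ≠ 0 := by
    rw [← hRd]
    exact leadingCoeff_ne_zero.2 hR0
  set S' := S - C (S.coeff d / R.coeff d) * R with hS'
  have hwe : wronskian R S' = wronskian R S := by
    rw [hS', wronskian, wronskian]
    simp only [derivative_sub, derivative_mul, derivative_C, zero_mul, zero_add]
    ring
  have hS'd : S'.natDegree ≤ d := (natDegree_sub_le _ _).trans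
    (max_le hS ((natDegree_C_mul_le _ _).trans hR))
  have hS'c : S'.coeff d = 0 := by
    rw [hS', coeff_sub, coeff_C_mul, div_mul_cancel₀ _ hc, sub_self]
  have hS'0 : S' ≠ 0 := by
    intro h0
    rw [h0, wronskian_zero_right] at hwe
    exact hW hwe.symm
  have hS'lt : S'.natDegree ≠ d := by
    intro h0
    rw [← h0] at hS'c
    exact hS'0 (leadingCoeff_eq_zero.1 hS'c)
  have := natDegree_wronskian_lt_add (hwe.symm ▸ hW)
  rw [hwe] at this
  omega

/-- At a finite point, `(X - t) ^ (m - 1)` divides both `R` and `R'`. At infinity it is the degree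
bound `deg W ≤ deg R + d - 1`. -/
theorem formMult_sub_one_le (hS : S.natDegree ≤ d)
    (hW : wronskian R S ≠ 0) (t : OnePoint ℂ) :
    formMult d R t - 1 ≤ formMult (2 * d - 2) (wronskian R S) t := by
  cases t with
  | infty =>
    change d - R.natDegree - 1 ≤ 2 * d - 2 - (wronskian R S).natDegree
    have := natDegree_wronskian_lt_add hW
    omega
  | coe t =>
    change R.rootMultiplicity t - 1 ≤ (wronskian R S).rootMultiplicity t
    rw [le_rootMultiplicity_iff hW, wronskian]
    refine dvd_sub (Dvd.dvd.mul_right ?_ _) (Dvd.dvd.mul_right ?_ _)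
    · exact (pow_dvd_pow _ (Nat.sub_le _ _)).trans (pow_rootMultiplicity_dvd R t)
    · exact pow_sub_one_dvd_derivative_of_pow_dvd (pow_rootMultiplicity_dvd R t)

/-- The behaviour of the substitution of a local parameter into a binary form, up to a factor
which depends only on the point and on the degree. -/
theorem exists_formMult_eq (d : ℕ) (t : OnePoint ℂ) : ∃ ε : ℂ → ℂ, (∀ σ, σ ≠ 0 → ε σ ≠ 0) ∧
    ∀ R : ℂ[X], R ≠ 0 → R.natDegree ≤ d → ∃ k : ℂ → ℂ, AnalyticAt ℂ k 0 ∧ k 0 ≠ 0 ∧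
      ∀ σ, σ ≠ 0 → R.eval (localParam t σ) = ε σ * (σ ^ formMult d R t * k σ) := by
  cases t with
  | infty =>
    -- This factor is common to all forms of degree `d`, so it cancels in quotients such as `φ`
    -- itself.
    refine ⟨fun σ => (σ ^ d)⁻¹, fun σ hσ => inv_ne_zero (pow_ne_zero d hσ), fun R hR hd => ?_⟩
    refine ⟨fun σ => R.reverse.eval σ, AnalyticOnNhd.eval_polynomial _ 0 (Set.mem_univ _), ?_, ?_⟩
    · change R.reverse.eval 0 ≠ 0
      rw [← coeff_zero_eq_eval_zero, coeff_zero_reverse]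
      exact leadingCoeff_ne_zero.2 hR
    · intro σ hσ
      change R.eval σ⁻¹ = (σ ^ d)⁻¹ * (σ ^ (d - R.natDegree) * R.reverse.eval σ)
      let inv : Invertible (σ⁻¹) := ⟨σ, mul_inv_cancel₀ hσ, inv_mul_cancel₀ hσ⟩
      have h : R.reverse.eval σ * σ⁻¹ ^ R.natDegree = R.eval σ⁻¹ :=
        eval₂_reverse_mul_pow (RingHom.id ℂ) (σ⁻¹) R
      rw [← h]
      have hpow : σ ^ d = σ ^ (d - R.natDegree) * σ ^ R.natDegree := by
        rw [← pow_add, Nat.sub_add_cancel hd]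
      rw [hpow, inv_pow]
      field_simp
  | coe t =>
    refine ⟨fun _ => 1, fun _ _ => one_ne_zero, fun R hR _ => ?_⟩
    obtain ⟨S, hS, hnd⟩ := exists_eq_pow_rootMultiplicity_mul_and_not_dvd R hR t
    refine ⟨fun σ => S.eval (t + σ), ?_, ?_, ?_⟩
    · exact AnalyticAt.fun_comp (AnalyticOnNhd.eval_polynomial S _ (Set.mem_univ _))
        (analyticAt_const.add analyticAt_id)
    · simpa [dvd_iff_isRoot] using hnd
    · intro σ _
      change R.eval (t + σ) = 1 * (σ ^ R.rootMultiplicity t * S.eval (t + σ))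
      conv_lhs => rw [hS]
      simp

end BinaryForms

/-! ### The pencil of binary forms of a rational map -/

namespace RatMap

open Polynomial

/-- The form which vanishes on the fibre of `φ` above `p`. -/
noncomputable def fiberForm (φ : RatFunc ℂ) : OnePoint ℂ → ℂ[X]
  | none => φ.denom
  | some c => φ.num - C c * φ.denom

/-- A form which together with `fiberForm φ p` spans the pencil of `φ`. -/
noncomputable def coFiberForm (φ : RatFunc ℂ) : OnePoint ℂ → ℂ[X]
  | none => -φ.num
  | some _ => φ.denom

/-- The fibre of `φ` above the point `p` of the sphere. -/
noncomputable def fiber (φ : RatFunc ℂ) (p : OnePoint ℂ) : Finset (OnePoint ℂ) :=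
  formZeros (degree φ) (fiberForm φ p)

/-- The multiplicity with which `φ` takes the value `p` at `t`. -/
noncomputable def ramIndex (φ : RatFunc ℂ) (p t : OnePoint ℂ) : ℕ :=
  formMult (degree φ) (fiberForm φ p) t

variable {φ : RatFunc ℂ}

theorem natDegree_num_le (φ : RatFunc ℂ) : φ.num.natDegree ≤ degree φ := le_max_left _ _

theorem natDegree_denom_le (φ : RatFunc ℂ) : φ.denom.natDegree ≤ degree φ := le_max_right _ _

theorem natDegree_fiberForm_le (φ : RatFunc ℂ) (p : OnePoint ℂ) :
    (fiberForm φ p).natDegree ≤ degree φ := by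
  cases p with
  | infty => exact natDegree_denom_le φ
  | coe c =>
    exact (natDegree_sub_le φ.num (C c * φ.denom)).trans
      (max_le (natDegree_num_le φ) ((natDegree_C_mul_le _ _).trans (natDegree_denom_le φ)))

theorem natDegree_coFiberForm_le (φ : RatFunc ℂ) (p : OnePoint ℂ) :
    (coFiberForm φ p).natDegree ≤ degree φ := by
  cases p with
  | infty => exact (natDegree_neg φ.num).le.trans (natDegree_num_le φ)
  | coe c => exact natDegree_denom_le φ

/-- The two forms arise from numerator and denominator by a substitution of determinant 1. One
Wronskian thus controls the ramification above every `p`. -/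
theorem wronskian_fiberForm (φ : RatFunc ℂ) (p : OnePoint ℂ) :
    wronskian (fiberForm φ p) (coFiberForm φ p) = wronskian φ.num φ.denom := by
  cases p with
  | infty =>
    change wronskian φ.denom (-φ.num) = _
    rw [wronskian_neg_right, wronskian_neg_eq]
  | coe c =>
    change wronskian (φ.num - C c * φ.denom) φ.denom = _
    simp only [wronskian, derivative_sub, derivative_mul, derivative_C, zero_mul, zero_add]
    ring

theorem wronskian_ne_zero (hd : degree φ ≠ 0) : wronskian φ.num φ.denom ≠ 0 := by
  intro h
  obtain ⟨h1, h2⟩ := (RatFunc.isCoprime_num_denom φ).wronskian_eq_zero_iff.1 h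
  exact hd (by
    rw [degree, derivative_eq_zero.1 h1, derivative_eq_zero.1 h2, max_self])

theorem fiberForm_ne_zero (hd : degree φ ≠ 0) (p : OnePoint ℂ) : fiberForm φ p ≠ 0 := by
  intro h
  have := wronskian_fiberForm φ p
  rw [h, wronskian_zero_left] at this
  exact wronskian_ne_zero hd this.symm

theorem coFiberForm_ne_zero (hd : degree φ ≠ 0) (p : OnePoint ℂ) : coFiberForm φ p ≠ 0 := by
  intro h
  have := wronskian_fiberForm φ p
  rw [h, wronskian_zero_right] at this
  exact wronskian_ne_zero hd this.symm

theorem formEval_num_ne_zero_or_formEval_denom_ne_zero (φ : RatFunc ℂ) (t : OnePoint ℂ) :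
    formEval (degree φ) φ.num t ≠ 0 ∨ formEval (degree φ) φ.denom t ≠ 0 := by
  cases t with
  | infty =>
    change φ.num.coeff (degree φ) ≠ 0 ∨ φ.denom.coeff (degree φ) ≠ 0
    rcases max_choice φ.num.natDegree φ.denom.natDegree with h | h
    · by_cases h0 : φ.num = 0
      · right
        have : degree φ = φ.denom.natDegree := by simp [degree, h0]
        rw [this]
        exact leadingCoeff_ne_zero.2 φ.denom_ne_zero
      · left
        rw [degree, h]
        exact leadingCoeff_ne_zero.2 h0
    · right
      rw [degree, h]
      exact leadingCoeff_ne_zero.2 φ.denom_ne_zero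
  | coe t =>
    change φ.num.eval t ≠ 0 ∨ φ.denom.eval t ≠ 0
    by_contra! h
    obtain ⟨a, b, hab⟩ := RatFunc.isCoprime_num_denom φ
    have := congrArg (eval t) hab
    simp [h.1, h.2] at this

theorem formEval_fiberForm_coe (φ : RatFunc ℂ) (c : ℂ) (t : OnePoint ℂ) :
    formEval (degree φ) (fiberForm φ c) t =
      formEval (degree φ) φ.num t - c * formEval (degree φ) φ.denom t := by
  cases t with
  | infty =>
    change (φ.num - C c * φ.denom).coeff _ = φ.num.coeff _ - c * φ.denom.coeff _
    simp
  | coe t =>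
    change (φ.num - C c * φ.denom).eval t = φ.num.eval t - c * φ.denom.eval t
    simp

theorem mem_fiber_iff (hd : degree φ ≠ 0) {p t : OnePoint ℂ} :
    t ∈ fiber φ p ↔ ramIndex φ p t ≠ 0 :=
  mem_formZeros_iff (fiberForm_ne_zero hd p) t

theorem mem_fiber_iff_formEval (hd : degree φ ≠ 0) {p t : OnePoint ℂ} :
    t ∈ fiber φ p ↔ formEval (degree φ) (fiberForm φ p) t = 0 :=
  (mem_fiber_iff hd).trans
    (formMult_ne_zero_iff (fiberForm_ne_zero hd p) (natDegree_fiberForm_le φ p) t)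

theorem sum_ramIndex_fiber (φ : RatFunc ℂ) (p : OnePoint ℂ) :
    ∑ t ∈ fiber φ p, ramIndex φ p t = degree φ :=
  sum_formMult_formZeros (natDegree_fiberForm_le φ p)

/-- A common zero of two members of the pencil would be a common zero of numerator and denominator,
which coprimality excludes at finite points and the choice of `degree φ` excludes at infinity. -/
theorem disjoint_fiber (hd : degree φ ≠ 0) {p q : OnePoint ℂ} (hpq : p ≠ q) :
    Disjoint (fiber φ p) (fiber φ q) := by
  rw [Finset.disjoint_left]
  intro t hp hq
  rw [mem_fiber_iff_formEval hd] at hp hq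
  have hnd := formEval_num_ne_zero_or_formEval_denom_ne_zero φ t
  have key : ∀ c : ℂ, formEval (degree φ) (fiberForm φ c) t = 0 →
      formEval (degree φ) φ.denom t = 0 → False := by
    intro c h1 h2
    rw [formEval_fiberForm_coe, h2, mul_zero, sub_zero] at h1
    exact hnd.elim (fun h => h h1) (fun h => h h2)
  cases p with
  | infty =>
    cases q with
    | infty => exact hpq rfl
    | coe c => exact key c hq hp
  | coe c =>
    cases q with
    | infty => exact key c hp hq
    | coe c' =>
      refine key c hp ?_
      rw [formEval_fiberForm_coe] at hp hq
      refine (mul_eq_zero.1 ?_).resolve_left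
        (sub_ne_zero.2 fun h => hpq (congrArg ((↑) : ℂ → OnePoint ℂ) h) : c - c' ≠ 0)
      linear_combination hq - hp

theorem formEval_coFiberForm_ne_zero (hd : degree φ ≠ 0) {p t : OnePoint ℂ} (ht : t ∈ fiber φ p) :
    formEval (degree φ) (coFiberForm φ p) t ≠ 0 := by
  rw [mem_fiber_iff_formEval hd] at ht
  have hnd := formEval_num_ne_zero_or_formEval_denom_ne_zero φ t
  cases p with
  | infty =>
    have h : formEval (degree φ) φ.num t ≠ 0 := hnd.resolve_right (not_not.2 ht)
    intro h0
    apply h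
    cases t with
    | infty => exact neg_eq_zero.1 ((coeff_neg _ _).symm.trans h0)
    | coe t => exact neg_eq_zero.1 ((eval_neg _ _).symm.trans h0)
  | coe c =>
    intro h0
    change formEval (degree φ) φ.denom t = 0 at h0
    rw [formEval_fiberForm_coe, h0, mul_zero, sub_zero] at ht
    exact hnd.elim (fun h => h ht) (fun h => h h0)

/-- Hurwitz's formula, as an inequality for the ramification above finitely many points. -/
theorem sum_sub_card_fiber_le (hd : degree φ ≠ 0) (V : Finset (OnePoint ℂ)) :
    ∑ p ∈ V, (degree φ - (fiber φ p).card) ≤ 2 * degree φ - 2 := by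
  classical
  set W := wronskian φ.num φ.denom with hW
  have hW0 : W ≠ 0 := wronskian_ne_zero hd
  have hle : ∀ p t, ramIndex φ p t - 1 ≤ formMult (2 * degree φ - 2) W t := by
    intro p t
    rw [hW, ← wronskian_fiberForm φ p]
    exact formMult_sub_one_le (natDegree_coFiberForm_le φ p)
      (by rwa [wronskian_fiberForm]) t
  -- Each term is the sum of `e - 1` over a fibre. Since the fibres are disjoint, all these
  -- contributions fit among the zeros of the single form `W`.
  calc ∑ p ∈ V, (degree φ - (fiber φ p).card)
      ≤ ∑ p ∈ V, ∑ t ∈ fiber φ p, formMult (2 * degree φ - 2) W t := by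
        refine Finset.sum_le_sum fun p _ => ?_
        rw [Nat.sub_le_iff_le_add, Finset.card_eq_sum_ones, ← Finset.sum_add_distrib]
        conv_lhs => rw [← sum_ramIndex_fiber φ p]
        exact Finset.sum_le_sum fun t _ => by have := hle p t; omega
    _ = ∑ t ∈ V.biUnion (fiber φ), formMult (2 * degree φ - 2) W t :=
        (Finset.sum_biUnion fun p _ q _ hpq => disjoint_fiber hd hpq).symm
    _ ≤ 2 * degree φ - 2 :=
        sum_formMult_le hW0
          (natDegree_wronskian_le (natDegree_num_le φ) (natDegree_denom_le φ) hW0) _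

/-! ### Local normal form of a rational map and its ramification. -/

theorem toFun_eq (φ : RatFunc ℂ) (z : ℂ) : toFun φ z = φ.num.eval z / φ.denom.eval z := rfl

theorem eventually_denom_ne_zero (φ : RatFunc ℂ) (t : OnePoint ℂ) :
    ∀ᶠ σ in 𝓝[≠] 0, φ.denom.eval (localParam t σ) ≠ 0 := by
  obtain ⟨ε, hε, h⟩ := exists_formMult_eq (degree φ) t
  obtain ⟨k, hk, hk0, hkσ⟩ := h φ.denom φ.denom_ne_zero (natDegree_denom_le φ)
  filter_upwards [self_mem_nhdsWithin,
    nhdsWithin_le_nhds (hk.continuousAt.eventually_ne hk0)] with σ hσ hkn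
  rw [hkσ σ hσ]
  exact mul_ne_zero (hε σ hσ) (mul_ne_zero (pow_ne_zero _ hσ) hkn)

theorem eventually_analyticAt_toFun (φ : RatFunc ℂ) (t : OnePoint ℂ) :
    ∀ᶠ σ in 𝓝[≠] 0, AnalyticAt ℂ (toFun φ) (localParam t σ) := by
  filter_upwards [eventually_denom_ne_zero φ t] with σ hσ
  exact AnalyticAt.div (AnalyticOnNhd.eval_polynomial φ.num _ (Set.mem_univ _))
    (AnalyticOnNhd.eval_polynomial φ.denom _ (Set.mem_univ _)) hσ

theorem exists_toFun_localParam_eq (hd : degree φ ≠ 0) {p t : OnePoint ℂ} (ht : t ∈ fiber φ p) :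
    ∃ k : ℂ → ℂ, AnalyticAt ℂ k 0 ∧ k 0 ≠ 0 ∧
      ∀ᶠ σ in 𝓝[≠] 0, toFun φ (localParam t σ) = localParam p (σ ^ ramIndex φ p t * k σ) := by
  obtain ⟨ε, hε, h⟩ := exists_formMult_eq (degree φ) t
  obtain ⟨k, hk, hk0, hkσ⟩ := h _ (fiberForm_ne_zero hd p) (natDegree_fiberForm_le φ p)
  obtain ⟨l, hl, hl0, hlσ⟩ := h _ (coFiberForm_ne_zero hd p) (natDegree_coFiberForm_le φ p)
  have hm : formMult (degree φ) (coFiberForm φ p) t = 0 := by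
    by_contra h0
    exact formEval_coFiberForm_ne_zero hd ht
      ((formMult_ne_zero_iff (coFiberForm_ne_zero hd p) (natDegree_coFiberForm_le φ p) t).1 h0)
  have hq : ∀ᶠ σ in 𝓝[≠] 0, (fiberForm φ p).eval (localParam t σ) /
      (coFiberForm φ p).eval (localParam t σ) = σ ^ ramIndex φ p t * (k σ / l σ) := by
    filter_upwards [self_mem_nhdsWithin] with σ hσ
    rw [hkσ σ hσ, hlσ σ hσ, hm, mul_div_mul_left _ _ (hε σ hσ), pow_zero, one_mul, ramIndex,
      mul_div_assoc]
  cases p with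
  | infty =>
    refine ⟨fun σ => -(k σ / l σ), (hk.div hl hl0).neg, neg_ne_zero.2 (div_ne_zero hk0 hl0), ?_⟩
    filter_upwards [hq] with σ h1
    change _ = (σ ^ ramIndex φ OnePoint.infty t * -(k σ / l σ))⁻¹
    rw [mul_neg, ← h1, toFun_eq]
    change _ = (-(φ.denom.eval _ / (-φ.num).eval _))⁻¹
    rw [eval_neg, div_neg, neg_neg, inv_div]
  | coe c =>
    refine ⟨fun σ => k σ / l σ, hk.div hl hl0, div_ne_zero hk0 hl0, ?_⟩
    filter_upwards [hq, eventually_denom_ne_zero φ t] with σ h1 h2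
    change _ = c + σ ^ ramIndex φ (c : OnePoint ℂ) t * (k σ / l σ)
    rw [← h1, toFun_eq]
    change _ = c + (φ.num - C c * φ.denom).eval _ / φ.denom.eval _
    rw [eval_sub, eval_mul, eval_C]
    field_simp
    ring

/-- The order of `φ - c` at `t` is `ramIndex φ c t` minus the multiplicity of the denominator. The
hypothesis `hc` excludes the constant map `c`, for which the order is `⊤`. -/
theorem exists_two_le_ramIndex {c : ℂ} (hc : fiberForm φ c ≠ 0) (h : RamifiesAbove φ c) :
    ∃ t, 2 ≤ ramIndex φ c t := by
  obtain ⟨t, ht⟩ := h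
  refine ⟨t, ?_⟩
  obtain ⟨ε, hε, h⟩ := exists_formMult_eq (degree φ) t
  obtain ⟨k, hk, hk0, hkσ⟩ := h _ hc (natDegree_fiberForm_le φ c)
  obtain ⟨l, hl, hl0, hlσ⟩ := h φ.denom φ.denom_ne_zero (natDegree_denom_le φ)
  set m := formMult (degree φ) φ.denom t
  have hev : ∀ᶠ σ in 𝓝[≠] (0 : ℂ), toFun φ (localParam t σ) - c =
      (σ - 0) ^ ((ramIndex φ c t : ℤ) - m) • (k σ / l σ) := by
    filter_upwards [self_mem_nhdsWithin, eventually_denom_ne_zero φ t,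
      nhdsWithin_le_nhds (hl.continuousAt.eventually_ne hl0)] with σ hσ h2 h3
    have hσ' : σ ≠ 0 := hσ
    have h4 : toFun φ (localParam t σ) - c =
        (fiberForm φ c).eval (localParam t σ) / φ.denom.eval (localParam t σ) := by
      change _ = (φ.num - C c * φ.denom).eval _ / _
      rw [toFun_eq, eval_sub, eval_mul, eval_C]
      field_simp
    rw [h4, hkσ σ hσ, hlσ σ hσ, mul_div_mul_left _ _ (hε σ hσ), sub_zero, zpow_sub₀ hσ',
      zpow_natCast, zpow_natCast, smul_eq_mul, div_mul_div_comm, ramIndex]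
  have hmer : MeromorphicAt (fun s => toFun φ (localParam t s) - c) 0 := by
    refine MeromorphicAt.congr ?_ (EventuallyEq.symm hev)
    exact (((MeromorphicAt.id 0).sub (MeromorphicAt.const 0 0)).zpow _).smul
      (hk.div hl hl0).meromorphicAt
  rw [(meromorphicOrderAt_eq_int_iff hmer).2
    ⟨fun σ => k σ / l σ, hk.div hl hl0, div_ne_zero hk0 hl0, hev⟩] at ht
  have : (2 : ℤ) ≤ (ramIndex φ c t : ℤ) - m := WithTop.coe_le_coe.1 ht
  omega

theorem ramIndex_le_degree {c : ℂ} (hc : fiberForm φ c ≠ 0) (t : OnePoint ℂ) :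
    ramIndex φ c t ≤ degree φ :=
  (Finset.sum_singleton (ramIndex φ c) t).ge.trans
    (sum_formMult_le hc (natDegree_fiberForm_le φ c) {t})

theorem card_fiber_lt_degree (hd : degree φ ≠ 0) {c : ℂ} (h : RamifiesAbove φ c) :
    (fiber φ c).card < degree φ := by
  obtain ⟨t, ht⟩ := exists_two_le_ramIndex (fiberForm_ne_zero hd c) h
  rw [← sum_ramIndex_fiber φ c, Finset.card_eq_sum_ones]
  refine Finset.sum_lt_sum (fun s hs => ?_) ⟨t, (mem_fiber_iff hd).2 (by omega), ht⟩
  have := (mem_fiber_iff hd).1 hs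
  omega

/-- A constant map satisfies `RamifiesAbove` at its own value, so one branch value would not
suffice; with two, at least one has a nonzero fibre form. -/
theorem two_le_degree {c₁ c₂ : ℂ} (hne : c₁ ≠ c₂) (h₁ : RamifiesAbove φ c₁)
    (h₂ : RamifiesAbove φ c₂) : 2 ≤ degree φ := by
  by_cases h0 : fiberForm φ c₁ = 0
  · by_cases h0' : fiberForm φ c₂ = 0
    · exfalso
      change φ.num - C c₁ * φ.denom = 0 at h0
      change φ.num - C c₂ * φ.denom = 0 at h0'
      have : C (c₁ - c₂) * φ.denom = 0 := by
        rw [C_sub]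
        linear_combination h0' - h0
      rcases mul_eq_zero.1 this with h | h
      · exact hne (sub_eq_zero.1 (C_eq_zero.1 h))
      · exact φ.denom_ne_zero h
    · obtain ⟨t, ht⟩ := exists_two_le_ramIndex h0' h₂
      exact ht.trans (ramIndex_le_degree h0' t)
  · obtain ⟨t, ht⟩ := exists_two_le_ramIndex h0 h₁
    exact ht.trans (ramIndex_le_degree h0 t)

end RatMap

/-! ### Counting the points above `0, 1, ∞`. -/

theorem recip_nonneg (p : ℕ∞) : 0 ≤ recip p := ENNReal.toReal_nonneg

theorem recip_le_one {p : ℕ∞} (hp : 1 ≤ p) : recip p ≤ 1 := by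
  have h : ((p : ENNReal)⁻¹) ≤ 1 := ENNReal.inv_le_one.2 (by exact_mod_cast hp)
  simpa [recip] using ENNReal.toReal_mono ENNReal.one_ne_top h

theorem recip_anti {p q : ℕ∞} (hp : 1 ≤ p) (hpq : p ≤ q) : recip q ≤ recip p := by
  refine ENNReal.toReal_mono ?_ (ENNReal.inv_le_inv.2 (by exact_mod_cast hpq))
  rw [ENNReal.inv_ne_top]
  have : p ≠ 0 := (zero_lt_one.trans_le hp).ne'
  exact_mod_cast this

theorem one_le_of_ofReal_sq_eq_int_sq {x : ℝ} (hx : 0 ≤ x) {n : ℤ} (hn : n ≠ 0)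
    (h : (x : ℂ) ^ 2 = (n : ℂ) ^ 2) : 1 ≤ x := by
  have h' : x ^ 2 = (n : ℝ) ^ 2 := by exact_mod_cast h
  have hn1 : (1 : ℝ) ≤ (n : ℝ) ^ 2 := by
    have : 0 < n ^ 2 := by positivity
    exact_mod_cast Int.add_one_le_iff.2 this
  nlinarith

namespace RatMap

/-- At an apparent point of the fibre above a point of exponent `r`, the multiplicity is at least
`1 / r`. -/
theorem one_le_ramIndex_mul {E : LinODE} {φ : RatFunc ℂ} (hd : degree φ ≠ 0) {p t : OnePoint ℂ}
    {r : ℝ} (hr : 0 ≤ r) (hE : E.HasExponentAt p (r : ℂ)) (ht : t ∈ fiber φ p)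
    (htriv : t ∉ (E.pullback (toFun φ)).nonApparent) : 1 ≤ ramIndex φ p t * r := by
  obtain ⟨k, hk, hk0, hkσ⟩ := exists_toFun_localParam_eq hd ht
  obtain ⟨n, hn, h⟩ := hE.exists_int_of_hasTrivialMonodromyAt ((mem_fiber_iff hd).1 ht) hk hk0
    (eventually_analyticAt_toFun φ t) hkσ (not_not.1 htriv)
  exact one_le_of_ofReal_sq_eq_int_sq (by positivity) hn (by push_cast; exact h)

/-- Sum over the fibre of `1 ≤ e r` at apparent points and `1 ≤ e r + (1 - r)` at the others, the
latter because `e ≥ 1`. For weight `∞`, where `r = 0`, the first case cannot occur: every point of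
the fibre is non-apparent. -/
theorem card_fiber_le {E : LinODE} {φ : RatFunc ℂ} (hd : degree φ ≠ 0) {p : OnePoint ℂ}
    {r : ℝ} (hr : 0 ≤ r) (hE : E.HasExponentAt p (r : ℂ)) {N : Finset (OnePoint ℂ)}
    (hN : ∀ t, t ∈ N ↔ t ∈ (E.pullback (toFun φ)).nonApparent) [DecidableEq (OnePoint ℂ)] :
    ((fiber φ p).card : ℝ) ≤ degree φ * r + (fiber φ p ∩ N).card * (1 - r) := by
  have hle : ∀ t ∈ fiber φ p, (1 : ℝ) ≤ ramIndex φ p t * r + if t ∈ N then 1 - r else 0 := by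
    intro t ht
    split_ifs with h
    · have : (1 : ℝ) ≤ ramIndex φ p t := by
        exact_mod_cast Nat.one_le_iff_ne_zero.2 ((mem_fiber_iff hd).1 ht)
      nlinarith
    · rw [add_zero]
      exact one_le_ramIndex_mul hd hr hE ht fun h' => h ((hN t).2 h')
  have hsum := Finset.sum_le_sum hle
  rw [Finset.sum_add_distrib, ← Finset.sum_mul, ← Nat.cast_sum, sum_ramIndex_fiber,
    Finset.sum_ite_mem, Finset.sum_const, Finset.sum_const, nsmul_eq_mul, nsmul_eq_mul,
    mul_one] at hsum
  exact hsum

/-- Hurwitz for the five values `0, 1, ∞, c₁, c₂`: the last two each contribute at least 1, so `3 d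
- #φ⁻¹ {0, 1, ∞} + 2 ≤ 2 d - 2`. -/
theorem degree_add_four_le {φ : RatFunc ℂ} {c₁ c₂ : ℂ} (hne : c₁ ≠ c₂) (h₁0 : c₁ ≠ 0)
    (h₁1 : c₁ ≠ 1) (h₂0 : c₂ ≠ 0) (h₂1 : c₂ ≠ 1) (h₁ : RamifiesAbove φ c₁)
    (h₂ : RamifiesAbove φ c₂) :
    degree φ + 4 ≤ (fiber φ (0 : ℂ)).card + (fiber φ (1 : ℂ)).card +
      (fiber φ OnePoint.infty).card := by
  classical
  have h2 := two_le_degree hne h₁ h₂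
  have hd : degree φ ≠ 0 := by omega
  have hH := sum_sub_card_fiber_le hd
    {((0 : ℂ) : OnePoint ℂ), ((1 : ℂ) : OnePoint ℂ), OnePoint.infty, (c₁ : OnePoint ℂ),
      (c₂ : OnePoint ℂ)}
  rw [Finset.sum_insert (by simp [h₁0.symm, h₂0.symm]),
    Finset.sum_insert (by simp [h₁1.symm, h₂1.symm]),
    Finset.sum_insert (by simp), Finset.sum_insert (by simp [hne]), Finset.sum_singleton] at hH
  have hc₁ := card_fiber_lt_degree hd h₁
  have hc₂ := card_fiber_lt_degree hd h₂
  omega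

end RatMap

theorem mainTheorem8 (E : LinODE) (φ : RatFunc ℂ) (p₀ p₁ pInf : ℕ∞)
    (hp₀ : 2 ≤ p₀) (hp₀₁ : p₀ ≤ p₁) (hp₁Inf : p₁ ≤ pInf)
    (hyperbolic : recip p₀ + recip p₁ + recip pInf < 1)
    (hE : E.HasOrbifoldStructure p₀ p₁ pInf)
    (hram : ∃ c₁ c₂ : ℂ, c₁ ≠ c₂ ∧ c₁ ≠ 0 ∧ c₁ ≠ 1 ∧ c₂ ≠ 0 ∧ c₂ ≠ 1 ∧
      RatMap.RamifiesAbove φ c₁ ∧ RatMap.RamifiesAbove φ c₂)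
    (hfive : (E.pullback (RatMap.toFun φ)).nonApparent.ncard = 5) :
    (RatMap.degree φ : ℝ) * (1 - recip p₀ - recip p₁ - recip pInf) ≤ 1 - 5 * recip pInf := by
  classical
  obtain ⟨c₁, c₂, hne, h₁0, h₁1, h₂0, h₂1, h₁, h₂⟩ := hram
  obtain ⟨-, -, hE₀, hE₁, hEInf⟩ := hE
  have hd : RatMap.degree φ ≠ 0 := by
    have := RatMap.two_le_degree hne h₁ h₂
    omega
  -- An infinite set has `ncard` equal to 0, so the value 5 entails finiteness.
  have hfin : (E.pullback (RatMap.toFun φ)).nonApparent.Finite :=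
    Set.finite_of_ncard_ne_zero (by omega)
  set N := hfin.toFinset with hNdef
  have hN : ∀ t, t ∈ N ↔ t ∈ (E.pullback (RatMap.toFun φ)).nonApparent := fun t =>
    hfin.mem_toFinset
  have hNcard : N.card = 5 := by rw [← hfive, Set.ncard_eq_toFinset_card _ hfin]
  -- Only this inequality is needed, so it need not be shown that every non-apparent point lies
  -- above `0, 1, ∞`.
  have hcount : (RatMap.fiber φ (0 : ℂ) ∩ N).card + (RatMap.fiber φ (1 : ℂ) ∩ N).card +
      (RatMap.fiber φ OnePoint.infty ∩ N).card ≤ 5 := by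
    have d01 := RatMap.disjoint_fiber hd (p := (0 : ℂ)) (q := (1 : ℂ)) (by simp)
    have d0i := RatMap.disjoint_fiber hd (p := (0 : ℂ)) (q := OnePoint.infty) (by simp)
    have d1i := RatMap.disjoint_fiber hd (p := (1 : ℂ)) (q := OnePoint.infty) (by simp)
    rw [← Finset.card_union_of_disjoint
        (d01.mono Finset.inter_subset_left Finset.inter_subset_left),
      ← Finset.card_union_of_disjoint (Finset.disjoint_union_left.2
        ⟨d0i.mono Finset.inter_subset_left Finset.inter_subset_left,
          d1i.mono Finset.inter_subset_left Finset.inter_subset_left⟩), ← hNcard]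
    exact Finset.card_le_card (Finset.union_subset
      (Finset.union_subset Finset.inter_subset_right Finset.inter_subset_right)
      Finset.inter_subset_right)
  have hp₀1 : 1 ≤ p₀ := one_le_two.trans hp₀
  have hp₁1 : 1 ≤ p₁ := hp₀1.trans hp₀₁
  have k₀ := RatMap.card_fiber_le hd (recip_nonneg p₀) hE₀ hN
  have k₁ := RatMap.card_fiber_le hd (recip_nonneg p₁) hE₁ hN
  have kInf := RatMap.card_fiber_le hd (recip_nonneg pInf) hEInf hN
  have hfour := RatMap.degree_add_four_le hne h₁0 h₁1 h₂0 h₂1 h₁ h₂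
  have r₁ : recip pInf ≤ recip p₁ := recip_anti hp₁1 hp₁Inf
  have r₀ : recip pInf ≤ recip p₀ := r₁.trans (recip_anti hp₀1 hp₀₁)
  have rInf : recip pInf ≤ 1 := recip_le_one (hp₁1.trans hp₁Inf)
  set n₀ := (RatMap.fiber φ (0 : ℂ) ∩ N).card
  set n₁ := (RatMap.fiber φ (1 : ℂ) ∩ N).card
  set nInf := (RatMap.fiber φ OnePoint.infty ∩ N).card
  have hfour' : (RatMap.degree φ : ℝ) + 4 ≤ (RatMap.fiber φ (0 : ℂ)).card +
      (RatMap.fiber φ (1 : ℂ)).card + (RatMap.fiber φ OnePoint.infty).card := by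
    exact_mod_cast hfour
  have hcount' : (n₀ : ℝ) + n₁ + nInf ≤ 5 := by exact_mod_cast hcount
  -- Since `pInf` is the largest weight, `1 - recip pInf` is the largest cost of a non-apparent
  -- point, and it may be charged to all five.
  have m₀ : (n₀ : ℝ) * (1 - recip p₀) ≤ n₀ * (1 - recip pInf) := by gcongr
  have m₁ : (n₁ : ℝ) * (1 - recip p₁) ≤ n₁ * (1 - recip pInf) := by gcongr
  have m : ((n₀ : ℝ) + n₁ + nInf) * (1 - recip pInf) ≤ 5 * (1 - recip pInf) :=
    mul_le_mul_of_nonneg_right hcount' (by linarith)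
  linarith
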